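/- Let $(\Omega,\mathcal A,P)$ be a probability space. For a real random variable $X$ with distribution function $F_X$ put $F_X^{-1}(u)=\inf\{x\in\mathbb R: F_X(x)\ge u\}\in[-\infty,\infty]$, and let $X^+=\max(X,0)$ and $X^-=\max(-X,0)$. Let $g:[0,1]\to[0,1]$ be a distortion function, that is, an increasing right-continuous function with $\lim_{u\nearrow1}g(u)=g(1)=1$; integrals $\int_0^1 f\,\mathrm dg$ are Lebesgue integrals over $[0,1]$ with respect to the Borel probability measure $\mu_g$ with $\mu_g([0,u])=g(u)$, $u\in[0,1]$. Let $\phi:[0,\infty)\to[0,\infty)$ be a normalized Young function, that is, $\phi$ is convex, $\phi(0)=0$, $\lim_{t\to\infty}\phi(t)=\infty$ and $\phi(1)=1$; put $\phi(\infty)=\infty$. Let $L_g$ be the set of all $X$ with $\int_0^1|F_X^{-1}(1-u)|\,\mathrm dg(u)<\infty$, and for such $X$ let $\rho_g(X)=\int_0^1F_X^{-1}(1-u)\,\mathrm dg(u)$. Let $L_g^\phi$ be the set of all $X$ such that $\int_0^1\phi\big(|F_X^{-1}(1-u)|/a\big)\,\mathrm dg(u)<\infty$ for some $a>0$. For $Y\in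 L_g^\phi$ with $Y\ge0$ let $$\pi_{g,\phi,0}(Y)=\inf\Big\{a>0:\int_0^1\phi\Big(\frac{F_Y^{-1}(1-u)}{a}\Big)\,\mathrm dg(u)\le1\Big\},$$ and for $X\in L_g^\phi$ let $$\rho_{g,\phi,0}(X)=\inf_{x\in\mathbb R}\big(\pi_{g,\phi,0}((X-x)^+)+x\big).$$ Then $L^\infty\subset L_g^\phi$, and these quantities are well defined: for every $X\in L_g^\phi$ we have $X,X^+,-X^-\in L_g$, $(X-x)^+\in L_g^\phi$ with $\pi_{g,\phi,0}((X-x)^+)<\infty$ for all $x\in\mathbb R$, and $\rho_{g,\phi,0}(X)>-\infty$. Moreover, the left derivative $c_-$ and the right derivative $c_+$ of $\phi$ at $1$ exist and are positive, and for all $X\in L^\infty$, $$\rho_g(X)\le\rho_{g,\phi,0}(X)\le\frac{c_+}{c_-}\,\rho_g(X^+)+\frac{c_-}{c_+}\,\rho_g(-X^-).$$ If $\phi$ satisfies the $\Delta_2$-condition, that is, if there are $s\ge0$ and $K>0$ with $\phi(2t)\le K\phi(t)$ for all $t\ge s$, then these inequalities hold for all $X\in L_g^\phi$. -/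

import Mathlib

open MeasureTheory Set Filter Topology
open scoped ENNReal

noncomputable section

/-- A distortion function: an increasing right-continuous function `g : [0,1] → [0,1]` with
`lim_{u ↗ 1} g(u) = g(1) = 1`. -/
structure DistortionFunction where
  toFun : unitInterval → unitInterval
  mono : Monotone toFun
  right_cont : ∀ u, ContinuousWithinAt toFun (Ici u) u
  left_lim_one : Tendsto toFun (𝓝[<] 1) (𝓝 1)
  map_one : toFun 1 = 1

namespace DistortionFunction

/-- The extension of `g` to the real line by `0` on `(-∞,0)` and by `1` on `(1,∞)`, as a
Stieltjes function. -/
def stieltjes (g : DistortionFunction) : StieltjesFunction ℝ where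
  toFun x := if x < 0 then 0 else (g.toFun (projIcc 0 1 zero_le_one x) : ℝ)
  mono' := by
    intro x y hxy
    by_cases hx : x < 0
    · by_cases hy : y < 0
      · simp [hx, hy]
      · simpa [hx, hy] using (g.toFun (projIcc 0 1 zero_le_one y)).2.1
    · have hy : ¬ y < 0 := fun h => hx (hxy.trans_lt h)
      simpa [hx, hy] using g.mono (monotone_projIcc zero_le_one hxy)
  right_continuous' := by
    intro x
    by_cases hx : x < 0
    · refine (ContinuousAt.congr (f := fun _ => (0 : ℝ)) continuousAt_const ?_).continuousWithinAt
      filter_upwards [Iio_mem_nhds hx] with y hy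
      exact (if_pos hy).symm
    · have h1 : ContinuousWithinAt
          (fun y => (g.toFun (projIcc 0 1 zero_le_one y) : ℝ)) (Ici x) x := by
        refine continuous_subtype_val.continuousAt.comp_continuousWithinAt ?_
        exact (g.right_cont (projIcc 0 1 zero_le_one x)).comp
          continuous_projIcc.continuousWithinAt
          (fun y hy => mem_Ici.2 (monotone_projIcc zero_le_one (mem_Ici.1 hy)))
      refine h1.congr (fun y hy => ?_) ?_
      · exact if_neg fun h => hx (lt_of_le_of_lt hy h)
      · exact if_neg hx

/-- The Borel probability measure `μ_g`, characterized by `μ_g([0,u]) = g(u)` for `u ∈ [0,1]`.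
It is a measure on `ℝ` concentrated on `[0,1]`; it has an atom of mass `g(0)` at `0`. -/
def measure (g : DistortionFunction) : Measure ℝ := g.stieltjes.measure

end DistortionFunction

/-- A Young function `φ : [0,∞) → [0,∞)`: convex, `φ(0) = 0`, `φ(t) → ∞` as `t → ∞`.
Only the values of `φ` on `[0,∞)` matter. -/
structure IsYoungFunction (φ : ℝ → ℝ) : Prop where
  convex : ConvexOn ℝ (Ici 0) φ
  nonneg : ∀ t, 0 ≤ t → 0 ≤ φ t
  map_zero : φ 0 = 0
  tendsto_atTop : Tendsto φ atTop atTop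

/-- The `Δ₂`-condition. -/
def DeltaTwo (φ : ℝ → ℝ) : Prop :=
  ∃ s K : ℝ, 0 ≤ s ∧ 0 < K ∧ ∀ t, s ≤ t → φ (2 * t) ≤ K * φ t

/-- The extension of `φ` to `[0,∞]` by `φ(∞) = ∞`. -/
def youngExt (φ : ℝ → ℝ) (t : ℝ≥0∞) : ℝ≥0∞ :=
  if t = ⊤ then ⊤ else ENNReal.ofReal (φ t.toReal)

section Risks

variable {Ω : Type*} [MeasurableSpace Ω]

/-- The quantile function `F_X⁻¹(u) = inf {x ∈ ℝ : F_X(x) ≥ u}`, where `F_X(x) = P(X ≤ x)`, with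
values in `[-∞,∞]`; thus `F_X⁻¹(0) = -∞` and `F_X⁻¹(1) = ess sup X`. -/
def quantile (P : Measure Ω) (X : Ω → ℝ) (u : ℝ) : EReal :=
  sInf ((fun x : ℝ => (x : EReal)) '' {x : ℝ | u ≤ P.real {ω | X ω ≤ x}})

/-- `X ∈ L_g`, that is, `∫₀¹ |F_X⁻¹(1-u)| dg(u) < ∞`. -/
def MemLg (g : DistortionFunction) (P : Measure Ω) (X : Ω → ℝ) : Prop :=
  ∫⁻ u, (quantile P X (1 - u)).abs ∂g.measure < ⊤

/-- The distortion risk measure `ρ_g(X) = ∫₀¹ F_X⁻¹(1-u) dg(u)`, for `X ∈ L_g`. (For such `X`, the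
quantiles `F_X⁻¹(1-u)` are finite for `μ_g`-almost all `u`.) -/
def distortionRisk (g : DistortionFunction) (P : Measure Ω) (X : Ω → ℝ) : ℝ :=
  ∫ u, (quantile P X (1 - u)).toReal ∂g.measure

/-- `∫₀¹ φ(|F_X⁻¹(1-u)| / a) dg(u)`, for `a > 0`. If `X ≥ 0` then the absolute value has no effect,
since then `F_X⁻¹ ≥ 0` on `(0,1]`, and `μ_g({1}) = 0`. -/
def distortedModular (g : DistortionFunction) (φ : ℝ → ℝ) (P : Measure Ω) (X : Ω → ℝ) (a : ℝ) :
    ℝ≥0∞ :=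
  ∫⁻ u, youngExt φ ((quantile P X (1 - u)).abs / ENNReal.ofReal a) ∂g.measure

/-- `X ∈ L_g^φ`. -/
def MemLgPhi (g : DistortionFunction) (φ : ℝ → ℝ) (P : Measure Ω) (X : Ω → ℝ) : Prop :=
  ∃ a : ℝ, 0 < a ∧ distortedModular g φ P X a < ⊤

/-- The set of all `a > 0` with `∫₀¹ φ(F_X⁻¹(1-u) / a) dg(u) ≤ 1 - α`. -/
def premiumSet (g : DistortionFunction) (φ : ℝ → ℝ) (α : ℝ) (P : Measure Ω) (X : Ω → ℝ) : Set ℝ :=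
  {a : ℝ | 0 < a ∧ distortedModular g φ P X a ≤ ENNReal.ofReal (1 - α)}

/-- The Orlicz-Lorentz premium `π_{g,φ,α}(X)`, for `X ≥ 0` in `L_g^φ`. -/
def orliczLorentzPremium (g : DistortionFunction) (φ : ℝ → ℝ) (α : ℝ) (P : Measure Ω)
    (X : Ω → ℝ) : ℝ :=
  sInf (premiumSet g φ α P X)

/-- The function `x ↦ π_{g,φ,α}((X - x)⁺) + x`. -/
def shiftedPremium (g : DistortionFunction) (φ : ℝ → ℝ) (α : ℝ) (P : Measure Ω)
    (X : Ω → ℝ) (x : ℝ) : ℝ :=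
  orliczLorentzPremium g φ α P (fun ω => max (X ω - x) 0) + x

/-- The distortion Haezendonck-Goovaerts risk measure
`ρ_{g,φ,α}(X) = inf_{x ∈ ℝ} (π_{g,φ,α}((X - x)⁺) + x)`, for `X ∈ L_g^φ`. -/
def distortionHG (g : DistortionFunction) (φ : ℝ → ℝ) (α : ℝ) (P : Measure Ω) (X : Ω → ℝ) : ℝ :=
  ⨅ x : ℝ, shiftedPremium g φ α P X x

end Risks

end

namespace IsYoungFunction

/-! ### Young functions: convexity, and slopes at 1. -/

variable {φ : ℝ → ℝ}

theorem map_mul_le (hφ : IsYoungFunction φ) {c t : ℝ} (hc : 0 ≤ c) (hc1 : c ≤ 1) (ht : 0 ≤ t) :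
    φ (c * t) ≤ c * φ t := by
  have h := hφ.convex.2 (mem_Ici.2 ht) (mem_Ici.2 le_rfl) hc (sub_nonneg.2 hc1) (by ring)
  simpa [hφ.map_zero] using h

theorem monotoneOn (hφ : IsYoungFunction φ) : MonotoneOn φ (Ici 0) := by
  intro s hs t ht hst
  have hs' : 0 ≤ s := hs
  rcases hs'.eq_or_lt with rfl | hs0
  · rw [hφ.map_zero]
    exact hφ.nonneg t ht
  · have ht0 : 0 < t := hs0.trans_le hst
    have h1 : s / t ≤ 1 := (div_le_one ht0).2 hst
    have h := hφ.map_mul_le (div_nonneg hs' ht0.le) h1 ht0.le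
    rw [div_mul_cancel₀ _ ht0.ne'] at h
    exact h.trans (mul_le_of_le_one_left (hφ.nonneg t ht) h1)

/-- Nothing is known about `φ` on the negative axis; truncating the argument gives a globally
monotone function. -/
theorem measurable_comp_max (hφ : IsYoungFunction φ) : Measurable fun t => φ (max t 0) :=
  Monotone.measurable fun _ _ h =>
    hφ.monotoneOn (mem_Ici.2 (le_max_right _ _)) (mem_Ici.2 (le_max_right _ _))
      (max_le_max_right 0 h)

theorem measurable_comp {S : Type*} [MeasurableSpace S] (hφ : IsYoungFunction φ) {w : S → ℝ}
    (hw : Measurable w) (h0 : ∀ u, 0 ≤ w u) : Measurable fun u => φ (w u) := by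
  have h := hφ.measurable_comp_max.comp hw
  have e : (fun u => φ (w u)) = (fun t => φ (max t 0)) ∘ w := by
    funext u
    simp [max_eq_left (h0 u)]
  rwa [e]

theorem map_half_add_le (hφ : IsYoungFunction φ) {s t : ℝ} (hs : 0 ≤ s) (ht : 0 ≤ t) :
    φ ((s + t) / 2) ≤ (φ s + φ t) / 2 := by
  have h := hφ.convex.2 (mem_Ici.2 hs) (mem_Ici.2 ht) (by norm_num : (0 : ℝ) ≤ 1 / 2)
    (by norm_num : (0 : ℝ) ≤ 1 / 2) (by norm_num)
  simp only [smul_eq_mul] at h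
  have e : (s + t) / 2 = 1 / 2 * s + 1 / 2 * t := by ring
  rw [e]
  linarith

theorem one_mem_interior : (1 : ℝ) ∈ interior (Ici (0 : ℝ)) := by
  rw [interior_Ici]
  exact mem_Ioi.2 one_pos

theorem leftDeriv_le_rightDeriv (hφ : IsYoungFunction φ) {cm cp : ℝ}
    (hm : HasDerivWithinAt φ cm (Iio 1) 1) (hp : HasDerivWithinAt φ cp (Ioi 1) 1) : cm ≤ cp := by
  have h := hφ.convex.leftDeriv_le_rightDeriv_of_mem_interior one_mem_interior
  rwa [hm.derivWithin (uniqueDiffWithinAt_Iio 1), hp.derivWithin (uniqueDiffWithinAt_Ioi 1)] at h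

/-- The chord from (0, 0) to (1, 1) has slope 1, and chord slopes ending at 1 stay below the left
derivative. -/
theorem one_le_leftDeriv (hφ : IsYoungFunction φ) (hφ1 : φ 1 = 1) {cm : ℝ}
    (hm : HasDerivWithinAt φ cm (Iio 1) 1) : 1 ≤ cm := by
  have h := hφ.convex.slope_le_of_hasDerivWithinAt_Iio (mem_Ici.2 le_rfl)
    (mem_Ici.2 zero_le_one) one_pos hm
  simpa [slope, hφ.map_zero, hφ1] using h

/-- The affine function through `(1, 1)` with the left derivative as its slope supports `φ`. -/
theorem leftDeriv_affine_le (hφ : IsYoungFunction φ) (hφ1 : φ 1 = 1) {cm cp : ℝ}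
    (hm : HasDerivWithinAt φ cm (Iio 1) 1) (hp : HasDerivWithinAt φ cp (Ioi 1) 1)
    {t : ℝ} (ht : 0 ≤ t) : 1 + cm * (t - 1) ≤ φ t := by
  rcases lt_trichotomy t 1 with h | rfl | h
  · have h2 := hφ.convex.slope_le_of_hasDerivWithinAt_Iio (mem_Ici.2 ht)
      (mem_Ici.2 zero_le_one) h hm
    rw [slope_def_field, hφ1, div_le_iff₀ (sub_pos.2 h)] at h2
    linarith
  · simp [hφ1]
  · have h2 := hφ.convex.le_slope_of_hasDerivWithinAt_Ioi (mem_Ici.2 zero_le_one)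
      (mem_Ici.2 ht) h hp
    rw [slope_def_field, hφ1, le_div_iff₀ (sub_pos.2 h)] at h2
    have := mul_le_mul_of_nonneg_right (hφ.leftDeriv_le_rightDeriv hm hp) (sub_pos.2 h).le
    linarith

theorem exists_leftDeriv (hφ : IsYoungFunction φ) : ∃ cm, HasDerivWithinAt φ cm (Iio 1) 1 :=
  ⟨_, hφ.convex.hasDerivWithinAt_leftDeriv_of_mem_interior one_mem_interior⟩

theorem exists_rightDeriv (hφ : IsYoungFunction φ) : ∃ cp, HasDerivWithinAt φ cp (Ioi 1) 1 :=
  ⟨_, hφ.convex.hasDerivWithinAt_rightDeriv_of_mem_interior one_mem_interior⟩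

theorem le_self (hφ : IsYoungFunction φ) (hφ1 : φ 1 = 1) {t : ℝ} (ht : 1 ≤ t) : t ≤ φ t := by
  obtain ⟨cm, hm⟩ := hφ.exists_leftDeriv
  obtain ⟨cp, hp⟩ := hφ.exists_rightDeriv
  have h1 := hφ.leftDeriv_affine_le hφ1 hm hp (zero_le_one.trans ht)
  have h2 := mul_le_mul_of_nonneg_right (hφ.one_le_leftDeriv hφ1 hm) (sub_nonneg.2 ht)
  linarith

/-- The scaled increments `m (φ ((1 + h / m)⁺) - 1)` converge to the directional derivative. -/
theorem tendsto_scaled_increment (hφ1 : φ 1 = 1) {cm cp : ℝ}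
    (hm : HasDerivWithinAt φ cm (Iio 1) 1) (hp : HasDerivWithinAt φ cp (Ioi 1) 1) (h : ℝ) :
    Tendsto (fun m : ℕ => (m : ℝ) * (φ (max (1 + h / m) 0) - 1)) atTop
      (𝓝 (cp * max h 0 - cm * max (-h) 0)) := by
  have hlim : Tendsto (fun m : ℕ => 1 + h / (m : ℝ)) atTop (𝓝 1) := by
    simpa using (tendsto_const_div_atTop_nhds_zero_nat h).const_add 1
  have hnn : ∀ᶠ m : ℕ in atTop, 0 < 1 + h / (m : ℝ) := hlim.eventually (lt_mem_nhds one_pos)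
  -- For large `m` the truncation is inactive, and the scaled increment is `h` times the slope of
  -- `φ` between 1 and 1 + h/m.
  have key : ∀ {c : ℝ} {s : Set ℝ}, h ≠ 0 → (1 : ℝ) ∉ s → HasDerivWithinAt φ c s 1 →
      (∀ᶠ m : ℕ in atTop, 1 + h / (m : ℝ) ∈ s) →
      Tendsto (fun m : ℕ => (m : ℝ) * (φ (max (1 + h / m) 0) - 1)) atTop (𝓝 (h * c)) := by
    intro c s hne h1 hd hs
    have hsl := (hasDerivWithinAt_iff_tendsto_slope' h1).1 hd
    have hcomp := (hsl.comp (tendsto_nhdsWithin_iff.2 ⟨hlim, hs⟩)).const_mul h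
    refine hcomp.congr' ?_
    filter_upwards [hnn, eventually_gt_atTop 0] with m hm1 hm0
    have hm0' : (m : ℝ) ≠ 0 := by exact_mod_cast hm0.ne'
    rw [max_eq_left hm1.le, Function.comp_apply, slope_def_field, hφ1]
    rw [add_sub_cancel_left]
    field_simp
  rcases lt_trichotomy h 0 with hh | rfl | hh
  · have := key hh.ne (by simp) hm (by
      filter_upwards [eventually_gt_atTop 0] with m hm0
      have : h / (m : ℝ) < 0 := div_neg_of_neg_of_pos hh (by exact_mod_cast hm0)
      exact mem_Iio.2 (by linarith))
    convert this using 2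
    rw [max_eq_right hh.le, max_eq_left (by linarith)]
    ring
  · simp [hφ1]
  · have := key hh.ne' (by simp) hp (by
      filter_upwards [eventually_gt_atTop 0] with m hm0
      have : 0 < h / (m : ℝ) := div_pos hh (by exact_mod_cast hm0)
      exact mem_Ioi.2 (by linarith))
    convert this using 2
    rw [max_eq_left hh.le, max_eq_right (by linarith)]
    ring

/-- A uniform bound for the scaled increments. -/
theorem abs_scaled_increment_le (hφ : IsYoungFunction φ) (hφ1 : φ 1 = 1) {cm cp : ℝ}
    (hm : HasDerivWithinAt φ cm (Iio 1) 1) (hp : HasDerivWithinAt φ cp (Ioi 1) 1)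
    {m₀ m : ℝ} (hm₀ : 0 < m₀) (hmm : m₀ ≤ m) (h : ℝ) :
    |m * (φ (max (1 + h / m) 0) - 1)| ≤ cm * |h| + m₀ * (φ (1 + |h| / m₀) - 1) := by
  have hmp : 0 < m := hm₀.trans_le hmm
  have hcm : 0 ≤ cm := zero_le_one.trans (hφ.one_le_leftDeriv hφ1 hm)
  have hb : 0 ≤ |h| / m₀ := div_nonneg (abs_nonneg h) hm₀.le
  have hB : 0 ≤ φ (1 + |h| / m₀) - 1 := by
    have := hφ.le_self hφ1 (t := 1 + |h| / m₀) (by linarith)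
    linarith
  rcases le_or_gt 0 h with hh | hh
  · have hhm : 0 ≤ h / m := div_nonneg hh hmp.le
    rw [max_eq_left (by linarith), abs_of_nonneg hh]
    rw [abs_of_nonneg hh] at hB
    have h0 : 0 ≤ φ (1 + h / m) - 1 := by
      have := hφ.le_self hφ1 (t := 1 + h / m) (by linarith)
      linarith
    rw [abs_of_nonneg (mul_nonneg hmp.le h0)]
    have hx : 0 ≤ 1 + h / m₀ := add_nonneg zero_le_one (div_nonneg hh hm₀.le)
    -- The point 1 + h/m is the convex combination of 1 + h/m₀ and 1 with weight m₀/m on the former.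
    have hc := hφ.convex.2 (mem_Ici.2 hx) (mem_Ici.2 zero_le_one) (div_nonneg hm₀.le hmp.le)
      (sub_nonneg.2 ((div_le_one hmp).2 hmm)) (by ring)
    simp only [smul_eq_mul, hφ1] at hc
    have e : m₀ / m * (1 + h / m₀) + (1 - m₀ / m) * 1 = 1 + h / m := by
      field_simp
      ring
    rw [e] at hc
    have h3 : m * (φ (1 + h / m) - 1) ≤ m * (m₀ / m * (φ (1 + h / m₀) - 1)) :=
      mul_le_mul_of_nonneg_left (by linarith) hmp.le
    have e2 : m * (m₀ / m * (φ (1 + h / m₀) - 1)) = m₀ * (φ (1 + h / m₀) - 1) := by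
      field_simp
    have := mul_nonneg hcm hh
    linarith
  · have hhm : h / m < 0 := div_neg_of_neg_of_pos hh hmp
    have ht0 : 0 ≤ max (1 + h / m) 0 := le_max_right _ _
    have hle : φ (max (1 + h / m) 0) ≤ 1 := by
      refine le_of_le_of_eq ?_ hφ1
      exact hφ.monotoneOn (mem_Ici.2 ht0) (mem_Ici.2 zero_le_one)
        (max_le (by linarith) zero_le_one)
    -- The increment is nonpositive here, so only a lower bound is needed; the supporting line
    -- provides cm * h.
    have hge := hφ.leftDeriv_affine_le hφ1 hm hp ht0
    have h4 : cm * (h / m) ≤ cm * (max (1 + h / m) 0 - 1) :=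
      mul_le_mul_of_nonneg_left (by have := le_max_left (1 + h / m) 0; linarith) hcm
    rw [abs_of_nonpos (mul_nonpos_of_nonneg_of_nonpos hmp.le (by linarith)), abs_of_neg hh]
    rw [abs_of_neg hh] at hB
    have h5 : m * (cm * (h / m)) ≤ m * (φ (max (1 + h / m) 0) - 1) :=
      mul_le_mul_of_nonneg_left (by linarith) hmp.le
    have e : m * (cm * (h / m)) = cm * h := by field_simp
    have := mul_nonneg hm₀.le hB
    linarith

/-! ### Orlicz modulars on a probability space. -/

section Modular

variable {S : Type*} [MeasurableSpace S] {μ : Measure S} {y : S → ℝ} {a : ℝ}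

/-- If I is the modular at `a`, the scale a(1 + I) works: by convexity and φ(0) = 0 the modular
drops to at most I/(1 + I). -/
theorem exists_modular_le_one (hφ : IsYoungFunction φ) (ha : 0 < a)
    {z : S → ℝ} (hz0 : ∀ u, 0 ≤ z u) (hz : Measurable z)
    (hi : Integrable (fun u => φ (z u / a)) μ) :
    ∃ a', 0 < a' ∧ Integrable (fun u => φ (z u / a')) μ ∧ ∫ u, φ (z u / a') ∂μ ≤ 1 := by
  set I := ∫ u, φ (z u / a) ∂μ with hI
  have hI0 : 0 ≤ I := integral_nonneg fun u => hφ.nonneg _ (div_nonneg (hz0 u) ha.le)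
  have hc : 0 < 1 / (1 + I) := by positivity
  have hc1 : 1 / (1 + I) ≤ 1 := (div_le_one (by linarith)).2 (by linarith)
  have ha' : 0 < a * (1 + I) := by positivity
  have hle : ∀ u, φ (z u / (a * (1 + I))) ≤ 1 / (1 + I) * φ (z u / a) := fun u => by
    have e : z u / (a * (1 + I)) = 1 / (1 + I) * (z u / a) := by field_simp
    rw [e]
    exact hφ.map_mul_le hc.le hc1 (div_nonneg (hz0 u) ha.le)
  have hint : Integrable (fun u => φ (z u / (a * (1 + I)))) μ := by
    refine (hi.const_mul (1 / (1 + I))).mono' (hφ.measurable_comp (hz.div_const _)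
      fun u => div_nonneg (hz0 u) ha'.le).aestronglyMeasurable (ae_of_all _ fun u => ?_)
    rw [Real.norm_of_nonneg (hφ.nonneg _ (div_nonneg (hz0 u) ha'.le))]
    exact hle u
  refine ⟨a * (1 + I), ha', hint, (integral_mono hint (hi.const_mul _) hle).trans ?_⟩
  rw [integral_const_mul, ← hI, one_div_mul_eq_div]
  exact (div_le_one (by linarith)).2 (by linarith)

variable [IsProbabilityMeasure μ]

/-- The scale 2a comes from midpoint convexity: (|y| + b)/(2a) is the midpoint of |y|/a and b/a. -/
theorem integrable_comp_of_le (hφ : IsYoungFunction φ) (ha : 0 < a)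
    (hi : Integrable (fun u => φ (|y u| / a)) μ) {b : ℝ} (hb : 0 ≤ b) {w : S → ℝ}
    (hw : Measurable w) (hw0 : ∀ u, 0 ≤ w u) (hwb : ∀ u, w u ≤ (|y u| + b) / (2 * a)) :
    Integrable (fun u => φ (w u)) μ := by
  have hd : Integrable (fun u => (φ (|y u| / a) + φ (b / a)) / 2) μ :=
    (hi.add (integrable_const _)).div_const 2
  refine hd.mono' (hφ.measurable_comp hw hw0).aestronglyMeasurable (ae_of_all _ fun u => ?_)
  rw [Real.norm_of_nonneg (hφ.nonneg _ (hw0 u))]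
  have e : (|y u| + b) / (2 * a) = (|y u| / a + b / a) / 2 := by
    field_simp
  refine (hφ.monotoneOn (mem_Ici.2 (hw0 u)) (mem_Ici.2 ?_) (hwb u)).trans ?_
  · exact (hw0 u).trans (hwb u)
  · rw [e]
    exact hφ.map_half_add_le (div_nonneg (abs_nonneg _) ha.le) (div_nonneg hb ha.le)

theorem integrable_of_integrable_comp (hφ : IsYoungFunction φ) (hφ1 : φ 1 = 1) (ha : 0 < a)
    (hy : Measurable y) (hi : Integrable (fun u => φ (|y u| / a)) μ) : Integrable y μ := by
  have hd : Integrable (fun u => a * (1 + φ (|y u| / a))) μ :=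
    ((integrable_const _).add hi).const_mul a
  refine hd.mono' hy.aestronglyMeasurable (ae_of_all _ fun u => ?_)
  have h0 : 0 ≤ |y u| / a := div_nonneg (abs_nonneg _) ha.le
  have h1 : |y u| / a ≤ 1 + φ (|y u| / a) := by
    rcases le_total (|y u| / a) 1 with h | h
    · have := hφ.nonneg _ h0
      linarith
    · have := hφ.le_self hφ1 h
      linarith
  rw [Real.norm_eq_abs, mul_comm]
  exact (div_le_iff₀ ha).1 h1

/-- Integrating the supporting line at 1 gives 1 + c₋(E z/a - 1) ≤ 1, and c₋ > 0. -/
theorem integral_le_of_modular_le_one (hφ : IsYoungFunction φ) (hφ1 : φ 1 = 1) (ha : 0 < a)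
    {z : S → ℝ} (hz0 : ∀ u, 0 ≤ z u) (hz : Integrable z μ)
    (hi : Integrable (fun u => φ (z u / a)) μ) (h1 : ∫ u, φ (z u / a) ∂μ ≤ 1) :
    ∫ u, z u ∂μ ≤ a := by
  obtain ⟨cm, hm⟩ := hφ.exists_leftDeriv
  obtain ⟨cp, hp⟩ := hφ.exists_rightDeriv
  have hcm : 0 < cm := one_pos.trans_le (hφ.one_le_leftDeriv hφ1 hm)
  have hza : Integrable (fun u => z u / a) μ := hz.div_const a
  have hza1 : Integrable (fun u => z u / a - 1) μ := hza.sub (integrable_const _)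
  have hle : ∫ u, (1 + cm * (z u / a - 1)) ∂μ ≤ ∫ u, φ (z u / a) ∂μ :=
    integral_mono ((integrable_const _).add (hza1.const_mul cm)) hi
      fun u => hφ.leftDeriv_affine_le hφ1 hm hp (div_nonneg (hz0 u) ha.le)
  rw [integral_add (integrable_const _) (hza1.const_mul cm),
    integral_const_mul, integral_sub hza (integrable_const _), integral_div] at hle
  simp only [integral_const, probReal_univ, one_smul] at hle
  have h2 : cm * ((∫ u, z u ∂μ) / a - 1) ≤ 0 := by linarith
  have h3 : (∫ u, z u ∂μ) / a - 1 ≤ 0 := by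
    by_contra hn
    exact absurd h2 (not_le.2 (mul_pos hcm (not_le.1 hn)))
  exact (div_le_one ha).1 (by linarith)

/-- If `c₊ E (y - b)⁺ < c₋ E (y - b)⁻`, then `m` lies above the Luxemburg norm of
`(y - (b - m))⁺` for some `m > 0`. -/
theorem exists_shift_modular_le_one (hφ : IsYoungFunction φ) (hφ1 : φ 1 = 1) {cm cp : ℝ}
    (hm : HasDerivWithinAt φ cm (Iio 1) 1) (hp : HasDerivWithinAt φ cp (Ioi 1) 1)
    (ha : 0 < a) (hy : Measurable y) (hi : Integrable (fun u => φ (|y u| / a)) μ) (b : ℝ)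
    (hb : ∫ u, (cp * max (y u - b) 0 - cm * max (-(y u - b)) 0) ∂μ < 0) :
    ∃ m, 0 < m ∧ Integrable (fun u => φ (max (y u - (b - m)) 0 / m)) μ ∧
      ∫ u, φ (max (y u - (b - m)) 0 / m) ∂μ ≤ 1 := by
  -- From m ≥ N > 2a on, the arguments of `φ` fit the bound of `integrable_comp_of_le`, with the
  -- constant 1 absorbed into `b` as 2a.
  obtain ⟨N, hN⟩ := exists_nat_gt (2 * a)
  have hN0 : (0 : ℝ) < N := by linarith
  have hyi := hφ.integrable_of_integrable_comp hφ1 ha hy hi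
  have habs : ∀ u, |y u - b| ≤ |y u| + |b| := fun u => abs_sub _ _
  have hdom : ∀ m : ℕ, N ≤ m → ∀ u, 1 + |y u - b| / (m : ℝ) ≤
      (|y u| + (|b| + 2 * a)) / (2 * a) := fun m hm' u => by
    have hm1 : (N : ℝ) ≤ m := by exact_mod_cast hm'
    have h1 : |y u - b| / (m : ℝ) ≤ (|y u| + |b|) / (2 * a) :=
      div_le_div₀ (by positivity) (habs u) (by positivity) (by linarith)
    have e : (|y u| + (|b| + 2 * a)) / (2 * a) = 1 + (|y u| + |b|) / (2 * a) := by
      field_simp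
      ring
    linarith
  have hmeas : ∀ m : ℕ, Measurable fun u => max (1 + (y u - b) / (m : ℝ)) 0 := fun m =>
    (((hy.sub_const b).div_const _).const_add 1).max measurable_const
  have hInt : ∀ m : ℕ, N ≤ m → Integrable (fun u => φ (max (1 + (y u - b) / (m : ℝ)) 0)) μ :=
    fun m hm' => hφ.integrable_comp_of_le ha hi (b := |b| + 2 * a) (by positivity) (hmeas m)
      (fun u => le_max_right _ _) fun u => by
        refine le_trans (max_le ?_ (by positivity)) (hdom m hm' u)
        gcongr
        exact le_abs_self _
  have hIntB : Integrable (fun u => φ (1 + |y u - b| / (N : ℝ))) μ :=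
    hφ.integrable_comp_of_le ha hi (b := |b| + 2 * a) (by positivity)
      (by fun_prop) (fun u => by positivity) (hdom N le_rfl)
  have hlim : Tendsto (fun m : ℕ => ∫ u, (m : ℝ) * (φ (max (1 + (y u - b) / m) 0) - 1) ∂μ) atTop
      (𝓝 (∫ u, (cp * max (y u - b) 0 - cm * max (-(y u - b)) 0) ∂μ)) := by
    refine tendsto_integral_filter_of_dominated_convergence
      (fun u => cm * |y u - b| + N * (φ (1 + |y u - b| / (N : ℝ)) - 1)) ?_ ?_ ?_ ?_
    · exact Eventually.of_forall fun m => (((hφ.measurable_comp (hmeas m)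
        fun u => le_max_right _ _).sub_const 1).const_mul _).aestronglyMeasurable
    · filter_upwards [eventually_ge_atTop N] with m hm'
      exact ae_of_all _ fun u => hφ.abs_scaled_increment_le hφ1 hm hp hN0
        (by exact_mod_cast hm') _
    · exact ((hyi.sub (integrable_const b)).abs.const_mul cm).add
        ((hIntB.sub (integrable_const 1)).const_mul _)
    · exact ae_of_all _ fun u => tendsto_scaled_increment hφ1 hm hp _
  obtain ⟨m, hneg, hNm⟩ :=
    ((hlim.eventually (gt_mem_nhds hb)).and (eventually_ge_atTop N)).exists
  have hm0 : (0 : ℝ) < m := hN0.trans_le (by exact_mod_cast hNm)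
  have e : (fun u => φ (max (y u - (b - m)) 0 / (m : ℝ))) =
      fun u => φ (max (1 + (y u - b) / (m : ℝ)) 0) := by
    funext u
    rw [← max_div_div_right hm0.le, zero_div]
    congr 2
    field_simp
    ring
  refine ⟨m, hm0, e ▸ hInt m hNm, ?_⟩
  rw [e]
  rw [integral_const_mul, integral_sub (hInt m hNm) (integrable_const _)] at hneg
  simp only [integral_const, probReal_univ, one_smul] at hneg
  by_contra hn
  exact absurd hneg (not_lt.2 (mul_nonneg hm0.le (by linarith)))

end Modular

end IsYoungFunction

/-- The number `c₊/c₋ E y⁺ - c₋/c₊ E y⁻` lies above the expectile of `y` for the weights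
`c₊` and `c₋`. -/
theorem expectile_integral_neg {S : Type*} [MeasurableSpace S] {μ : Measure S}
    [IsProbabilityMeasure μ] {y : S → ℝ} (hy : Integrable y μ) {cm cp b : ℝ} (hcm : 0 < cm)
    (hcp : cm ≤ cp)
    (hb : cp / cm * ∫ u, max (y u) 0 ∂μ + cm / cp * ∫ u, -max (-y u) 0 ∂μ < b) :
    ∫ u, (cp * max (y u - b) 0 - cm * max (-(y u - b)) 0) ∂μ < 0 := by
  have hcp0 : 0 < cp := hcm.trans_le hcp
  have hpos : Integrable (fun u => max (y u) 0) μ := hy.pos_part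
  have hneg : Integrable (fun u => max (-y u) 0) μ := hy.neg_part
  have hyb := hy.sub (integrable_const b)
  have hposb : Integrable (fun u => max (y u - b) 0) μ := hyb.pos_part
  have hnegb : Integrable (fun u => max (-(y u - b)) 0) μ := hyb.neg_part
  set A := ∫ u, max (y u) 0 ∂μ with hA
  set B := ∫ u, max (-y u) 0 ∂μ with hB
  have hA0 : 0 ≤ A := integral_nonneg fun u => le_max_right _ _
  have hB0 : 0 ≤ B := integral_nonneg fun u => le_max_right _ _
  rw [integral_neg, ← hB] at hb
  -- The function t ↦ cp t⁺ - cm t⁻ has slopes between cm and cp: a shift by b ≥ 0 lowers it by at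
  -- least cm * b, a shift by b < 0 raises it by at most cp * |b|.
  set c := if 0 ≤ b then cm else cp with hc
  have hle : ∀ u, cp * max (y u - b) 0 - cm * max (-(y u - b)) 0 ≤
      cp * max (y u) 0 - cm * max (-y u) 0 - c * b := by
    intro u
    rw [hc]
    rcases le_total (y u) b with h1 | h1 <;> rcases le_total (y u) 0 with h2 | h2 <;>
      split_ifs with h3 <;>
      [rw [max_eq_right (sub_nonpos.2 h1), max_eq_left (neg_nonneg.2 (sub_nonpos.2 h1))];
       rw [max_eq_right (sub_nonpos.2 h1), max_eq_left (neg_nonneg.2 (sub_nonpos.2 h1))];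
       rw [max_eq_right (sub_nonpos.2 h1), max_eq_left (neg_nonneg.2 (sub_nonpos.2 h1))];
       rw [max_eq_right (sub_nonpos.2 h1), max_eq_left (neg_nonneg.2 (sub_nonpos.2 h1))];
       rw [max_eq_left (sub_nonneg.2 h1), max_eq_right (neg_nonpos.2 (sub_nonneg.2 h1))];
       rw [max_eq_left (sub_nonneg.2 h1), max_eq_right (neg_nonpos.2 (sub_nonneg.2 h1))];
       rw [max_eq_left (sub_nonneg.2 h1), max_eq_right (neg_nonpos.2 (sub_nonneg.2 h1))];
       rw [max_eq_left (sub_nonneg.2 h1), max_eq_right (neg_nonpos.2 (sub_nonneg.2 h1))]] <;>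
      first
      | rw [max_eq_right h2, max_eq_left (neg_nonneg.2 h2)]
        nlinarith
      | rw [max_eq_left h2, max_eq_right (neg_nonpos.2 h2)]
        nlinarith
  have hi2 : Integrable (fun u => cp * max (y u) 0 - cm * max (-y u) 0) μ :=
    (hpos.const_mul _).sub (hneg.const_mul _)
  have hint := integral_mono ((hposb.const_mul cp).sub (hnegb.const_mul cm))
    (hi2.sub (integrable_const (c * b))) hle
  simp only [Pi.sub_apply] at hint
  rw [integral_sub hi2 (integrable_const _), integral_sub (hpos.const_mul _) (hneg.const_mul _),
    integral_const_mul, integral_const_mul, ← hA, ← hB] at hint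
  simp only [integral_const, probReal_univ, one_smul] at hint
  refine hint.trans_lt ?_
  rw [hc]
  split_ifs with h
  · have h1 := mul_lt_mul_of_pos_left hb hcm
    have e : cm * (cp / cm * A + cm / cp * -B) = cp * A - cm * (cm / cp * B) := by
      field_simp
      ring
    have h2 : cm * (cm / cp * B) ≤ cm * B :=
      mul_le_mul_of_nonneg_left (mul_le_of_le_one_left hB0 ((div_le_one hcp0).2 hcp)) hcm.le
    linarith
  · have h1 := mul_lt_mul_of_pos_left hb hcp0
    have e : cp * (cp / cm * A + cm / cp * -B) = cp * (cp / cm * A) - cm * B := by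
      field_simp
      ring
    have h2 : cp * A ≤ cp * (cp / cm * A) :=
      mul_le_mul_of_nonneg_left (le_mul_of_one_le_left hA0 ((one_le_div hcm).2 hcp)) hcp0.le
    linarith

/-! ### The distortion measure and its concentration on [0, 1). -/

namespace DistortionFunction

variable (g : DistortionFunction)

theorem stieltjes_of_neg {x : ℝ} (hx : x < 0) : g.stieltjes x = 0 :=
  if_pos hx

theorem stieltjes_of_nonneg {x : ℝ} (hx : 0 ≤ x) :
    g.stieltjes x = (g.toFun (projIcc 0 1 zero_le_one x) : ℝ) :=
  if_neg (not_lt.2 hx)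

theorem tendsto_stieltjes_atBot : Tendsto g.stieltjes atBot (𝓝 0) :=
  tendsto_const_nhds.congr' <| by
    filter_upwards [eventually_lt_atBot 0] with x hx
    exact (g.stieltjes_of_neg hx).symm

theorem tendsto_stieltjes_atTop : Tendsto g.stieltjes atTop (𝓝 1) :=
  tendsto_const_nhds.congr' <| by
    filter_upwards [eventually_ge_atTop 1] with x hx
    rw [g.stieltjes_of_nonneg (zero_le_one.trans hx), projIcc_of_right_le _ hx]
    exact (congrArg Subtype.val g.map_one).symm

instance : IsProbabilityMeasure g.measure :=
  g.stieltjes.isProbabilityMeasure g.tendsto_stieltjes_atBot g.tendsto_stieltjes_atTop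

theorem measure_Iio_zero : g.measure (Iio 0) = 0 := by
  have h : Tendsto g.stieltjes (𝓝[<] 0) (𝓝 0) :=
    tendsto_const_nhds.congr' <| by
      filter_upwards [self_mem_nhdsWithin] with x hx
      exact (g.stieltjes_of_neg hx).symm
  rw [measure, g.stieltjes.measure_Iio g.tendsto_stieltjes_atBot,
    leftLim_eq_of_tendsto h]
  simp

theorem measure_Ici_one : g.measure (Ici 1) = 0 := by
  have hproj : Tendsto (projIcc (0 : ℝ) 1 zero_le_one) (𝓝[<] 1) (𝓝[<] 1) := by
    refine tendsto_nhdsWithin_iff.2 ⟨?_, ?_⟩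
    · have h := (continuous_projIcc (h := zero_le_one' ℝ)).tendsto 1
      rw [projIcc_right] at h
      exact h.mono_left nhdsWithin_le_nhds
    · filter_upwards [self_mem_nhdsWithin] with x hx
      have : projIcc (0 : ℝ) 1 zero_le_one x ≠ 1 := fun h =>
        absurd ((projIcc_eq_right zero_lt_one).1 h) (not_le.2 hx)
      exact lt_of_le_of_ne (show projIcc (0 : ℝ) 1 zero_le_one x ≤ 1 from
        (projIcc (0 : ℝ) 1 zero_le_one x).2.2) this
  have h : Tendsto g.stieltjes (𝓝[<] 1) (𝓝 1) := by
    have h1 := (continuous_subtype_val.tendsto (1 : unitInterval)).comp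
      (g.left_lim_one.comp hproj)
    refine h1.congr' ?_
    filter_upwards [Ioo_mem_nhdsLT (zero_lt_one' ℝ)] with x hx
    exact (g.stieltjes_of_nonneg hx.1.le).symm
  rw [measure, g.stieltjes.measure_Ici g.tendsto_stieltjes_atTop,
    leftLim_eq_of_tendsto h]
  simp

/-- Levels 1 - u then lie in (0, 1], away from level 0, where the quantile is -∞, and from levels
above 1, where it is +∞. -/
theorem ae_mem_Ico : ∀ᵐ u ∂g.measure, 0 ≤ u ∧ u < 1 := by
  have h0 : ∀ᵐ u ∂g.measure, u ∉ Iio (0 : ℝ) := measure_eq_zero_iff_ae_notMem.1 g.measure_Iio_zero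
  have h1 : ∀ᵐ u ∂g.measure, u ∉ Ici (1 : ℝ) := measure_eq_zero_iff_ae_notMem.1 g.measure_Ici_one
  filter_upwards [h0, h1] with u hu0 hu1
  exact ⟨not_lt.1 hu0, not_le.1 hu1⟩

end DistortionFunction

/-! ### Real-valued quantiles and their transformation under positive and negative parts. -/

section Quantile

variable {Ω : Type*} [MeasurableSpace Ω] {P : Measure Ω} {X : Ω → ℝ} {q v : ℝ}

theorem monotone_quantile (P : Measure Ω) (X : Ω → ℝ) : Monotone (quantile P X) := fun _ _ h =>
  sInf_le_sInf (image_mono fun _ hx => h.trans hx)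

theorem measurable_quantile_one_sub (P : Measure Ω) (X : Ω → ℝ) :
    Measurable fun u => quantile P X (1 - u) :=
  (monotone_quantile P X).measurable.comp (measurable_const.sub measurable_id)

/-- Testing the distribution function only at t ≠ q uses its monotonicity alone; whether the infimum
is attained plays no role. -/
theorem quantile_eq_coe_iff [IsFiniteMeasure P] :
    quantile P X v = (q : EReal) ↔
      (∀ t, q < t → v ≤ P.real {ω | X ω ≤ t}) ∧ ∀ t < q, P.real {ω | X ω ≤ t} < v := by
  constructor
  · intro h
    refine ⟨fun t ht => ?_, fun t ht => ?_⟩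
    · have h1 : quantile P X v < (t : EReal) := h ▸ EReal.coe_lt_coe_iff.2 ht
      obtain ⟨_, ⟨s, hs, rfl⟩, hst⟩ := sInf_lt_iff.1 h1
      exact hs.trans (measureReal_mono fun ω (hω : X ω ≤ s) =>
        hω.trans (EReal.coe_lt_coe_iff.1 hst).le)
    · by_contra hn
      have h1 : quantile P X v ≤ (t : EReal) := sInf_le ⟨t, not_lt.1 hn, rfl⟩
      rw [h] at h1
      exact absurd (EReal.coe_le_coe_iff.1 h1) (not_le.2 ht)
  · rintro ⟨h1, h2⟩
    refine le_antisymm ?_ ?_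
    · refine le_of_forall_gt_imp_ge_of_dense fun c hc => ?_
      obtain ⟨t, hqt, htc⟩ := EReal.lt_iff_exists_real_btwn.1 hc
      have hle : quantile P X v ≤ (t : EReal) :=
        sInf_le ⟨t, h1 t (EReal.coe_lt_coe_iff.1 hqt), rfl⟩
      exact hle.trans htc.le
    · refine le_sInf ?_
      rintro _ ⟨t, ht, rfl⟩
      refine EReal.coe_le_coe_iff.2 (not_lt.1 fun h => ?_)
      exact absurd ht (not_le.2 (h2 t h))

/-- The event (X - x)⁺ ≤ t is X ≤ t + x for t ≥ 0 and empty for t < 0; the empty case requires v >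
0. -/
theorem quantile_max_sub [IsFiniteMeasure P] (hv : 0 < v) (h : quantile P X v = (q : EReal))
    (x : ℝ) : quantile P (fun ω => max (X ω - x) 0) v = (max (q - x) 0 : ℝ) := by
  obtain ⟨h1, h2⟩ := quantile_eq_coe_iff.1 h
  refine quantile_eq_coe_iff.2 ⟨fun t ht => ?_, fun t ht => ?_⟩
  · obtain ⟨ht1, ht2⟩ := max_lt_iff.1 ht
    refine (h1 (t + x) (by linarith)).trans (measureReal_mono fun ω (hω : X ω ≤ t + x) => ?_)
    exact max_le (by linarith) ht2.le
  · rcases lt_or_ge t 0 with h0 | h0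
    · have e : {ω | max (X ω - x) 0 ≤ t} = ∅ :=
        eq_empty_of_forall_notMem fun ω hω => absurd ((le_max_right _ _).trans hω) (not_le.2 h0)
      rw [e]
      simpa using hv
    · have ht1 : t < q - x := (lt_max_iff.1 ht).resolve_right (not_lt.2 h0)
      refine lt_of_le_of_lt (measureReal_mono fun ω (hω : max (X ω - x) 0 ≤ t) => ?_)
        (h2 (t + x) (by linarith))
      have := (le_max_left _ _).trans hω
      exact sub_le_iff_le_add.1 this

/-- The event -X⁻ ≤ t is X ≤ t for t < 0 and the whole space for t ≥ 0; the latter case requires v ≤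
1. -/
theorem quantile_neg_max_neg [IsProbabilityMeasure P] (hv : v ≤ 1)
    (h : quantile P X v = (q : EReal)) :
    quantile P (fun ω => -max (-X ω) 0) v = (-max (-q) 0 : ℝ) := by
  obtain ⟨h1, h2⟩ := quantile_eq_coe_iff.1 h
  refine quantile_eq_coe_iff.2 ⟨fun t ht => ?_, fun t ht => ?_⟩
  · rcases lt_max_iff.1 (neg_lt.1 ht) with h0 | h0
    · refine (h1 t (neg_lt_neg_iff.1 h0)).trans (measureReal_mono fun ω (hω : X ω ≤ t) => ?_)
      exact neg_le.1 ((neg_le_neg hω).trans (le_max_left _ _))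
    · have e : {ω | -max (-X ω) 0 ≤ t} = univ := eq_univ_of_forall fun ω => by
        exact (neg_nonpos.2 (le_max_right (-X ω) 0)).trans (neg_neg_iff_pos.1 h0).le
      rw [e]
      simpa using hv
  · obtain ⟨ht1, ht2⟩ := max_lt_iff.1 (lt_neg.1 ht)
    refine lt_of_le_of_lt (measureReal_mono fun ω hω => ?_) (h2 t (neg_lt_neg_iff.1 ht1))
    have h3 : -t ≤ max (-X ω) 0 := neg_le.1 hω
    rcases le_max_iff.1 h3 with h4 | h4
    · exact neg_le_neg_iff.1 h4
    · linarith

theorem abs_quantile_le [IsProbabilityMeasure P] {C : ℝ} (hC : ∀ᵐ ω ∂P, |X ω| ≤ C) (hv : 0 < v)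
    (hv1 : v ≤ 1) : (quantile P X v).abs ≤ ENNReal.ofReal C := by
  have hle : quantile P X v ≤ (C : EReal) := by
    refine sInf_le ⟨C, ?_, rfl⟩
    have : P.real {ω | X ω ≤ C} = 1 := by
      have e : {ω | X ω ≤ C} =ᵐ[P] univ := eventuallyEq_univ.2 <| by
        filter_upwards [hC] with ω hω
        exact (le_abs_self _).trans hω
      rw [measureReal_congr e, probReal_univ]
    exact hv1.trans_eq this.symm
  have hge : ((-C : ℝ) : EReal) ≤ quantile P X v := by
    refine le_sInf ?_
    rintro _ ⟨t, ht, rfl⟩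
    refine EReal.coe_le_coe_iff.2 (not_lt.1 fun h => ?_)
    have h0 : P {ω | X ω ≤ t} = 0 := by
      refine measure_eq_zero_iff_ae_notMem.2 ?_
      filter_upwards [hC] with ω hω h1
      have h1 : X ω ≤ t := h1
      have := (abs_le.1 hω).1
      linarith
    have ht : v ≤ P.real {ω | X ω ≤ t} := ht
    rw [measureReal_def, h0] at ht
    simp only [ENNReal.toReal_zero] at ht
    linarith
  generalize quantile P X v = z at hle hge
  induction z with
  | bot => exact absurd hge (not_le.2 (EReal.bot_lt_coe _))
  | top => exact absurd hle (not_le.2 (EReal.coe_lt_top _))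
  | coe z =>
    rw [EReal.abs_def]
    exact ENNReal.ofReal_le_ofReal
      (abs_le.2 ⟨EReal.coe_le_coe_iff.1 hge, EReal.coe_le_coe_iff.1 hle⟩)

end Quantile

theorem EReal.measurable_abs : Measurable EReal.abs :=
  EReal.measurable_of_measurable_real
    (ENNReal.measurable_ofReal.comp continuous_abs.measurable)

namespace IsYoungFunction

variable {φ : ℝ → ℝ}

theorem monotone_youngExt (hφ : IsYoungFunction φ) : Monotone (youngExt φ) := by
  intro s t hst
  rcases eq_or_ne t ⊤ with rfl | ht
  · simp [youngExt]
  · have hs : s ≠ ⊤ := ne_top_of_le_ne_top ht hst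
    simp only [youngExt, if_neg ht, if_neg hs]
    exact ENNReal.ofReal_le_ofReal (hφ.monotoneOn (mem_Ici.2 ENNReal.toReal_nonneg)
      (mem_Ici.2 ENNReal.toReal_nonneg) (ENNReal.toReal_mono ht hst))

end IsYoungFunction

theorem youngExt_coe_abs_div (φ : ℝ → ℝ) (q : ℝ) {a : ℝ} (ha : 0 < a) :
    youngExt φ ((q : EReal).abs / ENNReal.ofReal a) = ENNReal.ofReal (φ (|q| / a)) := by
  rw [EReal.abs_def, ← ENNReal.ofReal_div_of_pos ha, youngExt, if_neg ENNReal.ofReal_ne_top,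
    ENNReal.toReal_ofReal (by positivity)]

/-! ### Transfer from risks to real representatives y of their quantiles. -/

section Representation

variable {Ω : Type*} [MeasurableSpace Ω] {P : Measure Ω} {X : Ω → ℝ} {g : DistortionFunction}
  {φ : ℝ → ℝ} {y : ℝ → ℝ} {a : ℝ}

theorem ae_quantile_max_sub [IsFiniteMeasure P]
    (h : ∀ᵐ u ∂g.measure, quantile P X (1 - u) = y u) (x : ℝ) :
    ∀ᵐ u ∂g.measure, quantile P (fun ω => max (X ω - x) 0) (1 - u) = (max (y u - x) 0 : ℝ) := by
  filter_upwards [h, g.ae_mem_Ico] with u hu hu1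
  exact quantile_max_sub (by linarith [hu1.2]) hu x

theorem ae_quantile_max [IsFiniteMeasure P]
    (h : ∀ᵐ u ∂g.measure, quantile P X (1 - u) = y u) :
    ∀ᵐ u ∂g.measure, quantile P (fun ω => max (X ω) 0) (1 - u) = (max (y u) 0 : ℝ) := by
  simpa using ae_quantile_max_sub h 0

theorem ae_quantile_neg_max_neg [IsProbabilityMeasure P]
    (h : ∀ᵐ u ∂g.measure, quantile P X (1 - u) = y u) :
    ∀ᵐ u ∂g.measure, quantile P (fun ω => -max (-X ω) 0) (1 - u) = (-max (-y u) 0 : ℝ) := by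
  filter_upwards [h, g.ae_mem_Ico] with u hu hu1
  exact quantile_neg_max_neg (by linarith [hu1.1]) hu

theorem memLg_of_integrable (h : ∀ᵐ u ∂g.measure, quantile P X (1 - u) = y u)
    (hy : Integrable y g.measure) : MemLg g P X := by
  have e : ∫⁻ u, (quantile P X (1 - u)).abs ∂g.measure = ∫⁻ u, ‖y u‖ₑ ∂g.measure := by
    refine lintegral_congr_ae ?_
    filter_upwards [h] with u hu
    rw [hu, EReal.abs_def, Real.enorm_eq_ofReal_abs]
  rw [MemLg, e]
  exact hy.2

theorem distortionRisk_eq_integral (h : ∀ᵐ u ∂g.measure, quantile P X (1 - u) = y u) :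
    distortionRisk g P X = ∫ u, y u ∂g.measure := by
  refine integral_congr_ae ?_
  filter_upwards [h] with u hu
  rw [hu, EReal.toReal_coe]

theorem distortedModular_eq_lintegral (h : ∀ᵐ u ∂g.measure, quantile P X (1 - u) = y u)
    (ha : 0 < a) :
    distortedModular g φ P X a = ∫⁻ u, ENNReal.ofReal (φ (|y u| / a)) ∂g.measure := by
  refine lintegral_congr_ae ?_
  filter_upwards [h] with u hu
  rw [hu, youngExt_coe_abs_div φ _ ha]

theorem distortedModular_lt_top_iff (hφ : IsYoungFunction φ) (hy : Measurable y)
    (h : ∀ᵐ u ∂g.measure, quantile P X (1 - u) = y u) (ha : 0 < a) :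
    distortedModular g φ P X a < ⊤ ↔ Integrable (fun u => φ (|y u| / a)) g.measure := by
  have h0 : ∀ u, 0 ≤ |y u| / a := fun u => by positivity
  have hm : Measurable fun u => φ (|y u| / a) := hφ.measurable_comp (by fun_prop) h0
  rw [distortedModular_eq_lintegral h ha, ← hasFiniteIntegral_iff_ofReal
    (ae_of_all _ fun u => hφ.nonneg _ (h0 u))]
  exact ⟨fun hi => ⟨hm.aestronglyMeasurable, hi⟩, fun hi => hi.2⟩

/-- Because φ(∞) = ∞, a finite modular excludes infinite quantiles almost everywhere. -/
theorem MemLgPhi.ae_quantile_eq (hφ : IsYoungFunction φ) (hX : MemLgPhi g φ P X) :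
    ∀ᵐ u ∂g.measure, quantile P X (1 - u) = ((quantile P X (1 - u)).toReal : EReal) := by
  obtain ⟨a, ha, hlt⟩ := hX
  have hm : Measurable fun u =>
      youngExt φ ((quantile P X (1 - u)).abs / ENNReal.ofReal a) :=
    hφ.monotone_youngExt.measurable.comp
      ((EReal.measurable_abs.comp (measurable_quantile_one_sub P X)).div_const _)
  filter_upwards [ae_lt_top hm hlt.ne] with u hu
  have hne : (quantile P X (1 - u)).abs ≠ ⊤ := fun h => by
    simp [h, youngExt, ENNReal.top_div] at hu
  refine (EReal.coe_toReal (fun h => hne ?_) fun h => hne ?_).symm <;> simp [h]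

/-- Integrability must be listed separately: the Bochner integral of a non-integrable function is 0
and would satisfy the bound vacuously. -/
theorem mem_premiumSet_zero_iff (hφ : IsYoungFunction φ) (hy : Measurable y) (hy0 : ∀ u, 0 ≤ y u)
    (h : ∀ᵐ u ∂g.measure, quantile P X (1 - u) = y u) :
    a ∈ premiumSet g φ 0 P X ↔ 0 < a ∧ Integrable (fun u => φ (y u / a)) g.measure ∧
      ∫ u, φ (y u / a) ∂g.measure ≤ 1 := by
  refine and_congr_right fun ha => ?_
  have h0 : ∀ u, 0 ≤ φ (y u / a) := fun u => hφ.nonneg _ (div_nonneg (hy0 u) ha.le)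
  have hfin := distortedModular_lt_top_iff hφ hy h ha
  have heq := distortedModular_eq_lintegral (φ := φ) h ha
  simp only [abs_of_nonneg (hy0 _)] at hfin heq
  have key : Integrable (fun u => φ (y u / a)) g.measure →
      (distortedModular g φ P X a ≤ ENNReal.ofReal (1 - 0) ↔ ∫ u, φ (y u / a) ∂g.measure ≤ 1) := by
    intro hi
    rw [heq, ← ofReal_integral_eq_lintegral_ofReal hi (ae_of_all _ h0), sub_zero,
      ENNReal.ofReal_le_ofReal_iff zero_le_one]
  constructor
  · intro hle
    have hi := hfin.1 (hle.trans_lt ENNReal.ofReal_lt_top)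
    exact ⟨hi, (key hi).1 hle⟩
  · rintro ⟨hi, hle⟩
    exact (key hi).2 hle

theorem bddBelow_premiumSet (g : DistortionFunction) (φ : ℝ → ℝ) (α : ℝ) (P : Measure Ω)
    (X : Ω → ℝ) : BddBelow (premiumSet g φ α P X) :=
  ⟨0, fun _ ha => ha.1.le⟩

theorem MemLgPhi.integrable (hφ : IsYoungFunction φ) (hφ1 : φ 1 = 1) (hX : MemLgPhi g φ P X) :
    Integrable (fun u => (quantile P X (1 - u)).toReal) g.measure := by
  have h := hX.ae_quantile_eq hφ
  obtain ⟨a, ha, hlt⟩ := hX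
  have hy := (measurable_quantile_one_sub P X).ereal_toReal
  exact hφ.integrable_of_integrable_comp hφ1 ha hy
    ((distortedModular_lt_top_iff hφ hy h ha).1 hlt)

theorem MemLgPhi.exists_integrable_max_sub (hφ : IsYoungFunction φ) (hX : MemLgPhi g φ P X)
    (x : ℝ) : ∃ a, 0 < a ∧
      Integrable (fun u => φ (max ((quantile P X (1 - u)).toReal - x) 0 / a)) g.measure := by
  have h := hX.ae_quantile_eq hφ
  obtain ⟨a, ha, hlt⟩ := hX
  have hy := (measurable_quantile_one_sub P X).ereal_toReal
  refine ⟨2 * a, by positivity, hφ.integrable_comp_of_le ha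
    ((distortedModular_lt_top_iff hφ hy h ha).1 hlt) (abs_nonneg x)
    (((hy.sub_const x).max measurable_const).div_const _) (fun u => by positivity) fun u => ?_⟩
  gcongr
  exact max_le ((le_abs_self _).trans (abs_sub _ _)) (by positivity)

variable [IsProbabilityMeasure P]

theorem memLgPhi_of_ae_abs_le (hφ : IsYoungFunction φ) {C : ℝ} (hC : ∀ᵐ ω ∂P, |X ω| ≤ C) :
    MemLgPhi g φ P X := by
  refine ⟨1, one_pos, ?_⟩
  have hle : distortedModular g φ P X 1 ≤ ∫⁻ _, youngExt φ (ENNReal.ofReal C) ∂g.measure := by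
    refine lintegral_mono_ae ?_
    filter_upwards [g.ae_mem_Ico] with u hu
    refine hφ.monotone_youngExt ?_
    rw [ENNReal.ofReal_one, div_one]
    exact abs_quantile_le hC (by linarith [hu.2]) (by linarith [hu.1])
  refine hle.trans_lt ?_
  rw [lintegral_const, measure_univ, mul_one, youngExt, if_neg ENNReal.ofReal_ne_top]
  exact ENNReal.ofReal_lt_top

theorem MemLgPhi.max_sub (hφ : IsYoungFunction φ) (hX : MemLgPhi g φ P X) (x : ℝ) :
    MemLgPhi g φ P (fun ω => max (X ω - x) 0) := by
  obtain ⟨a, ha, hi⟩ := hX.exists_integrable_max_sub hφ x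
  have hy := (measurable_quantile_one_sub P X).ereal_toReal
  refine ⟨a, ha, (distortedModular_lt_top_iff hφ ((hy.sub_const x).max measurable_const)
    (ae_quantile_max_sub (hX.ae_quantile_eq hφ) x) ha).2 ?_⟩
  simpa only [abs_of_nonneg (le_max_right _ (0 : ℝ))] using hi

theorem MemLgPhi.mem_premiumSet_max_sub_iff (hφ : IsYoungFunction φ) (hX : MemLgPhi g φ P X)
    (x : ℝ) : a ∈ premiumSet g φ 0 P (fun ω => max (X ω - x) 0) ↔ 0 < a ∧
      Integrable (fun u => φ (max ((quantile P X (1 - u)).toReal - x) 0 / a)) g.measure ∧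
      ∫ u, φ (max ((quantile P X (1 - u)).toReal - x) 0 / a) ∂g.measure ≤ 1 :=
  mem_premiumSet_zero_iff hφ
    (((measurable_quantile_one_sub P X).ereal_toReal.sub_const x).max measurable_const)
    (fun _ => le_max_right _ _) (ae_quantile_max_sub (hX.ae_quantile_eq hφ) x)

/-- Makes the premium a genuine infimum, not the default value `sInf ∅ = 0`. -/
theorem MemLgPhi.premiumSet_max_sub_nonempty (hφ : IsYoungFunction φ) (hX : MemLgPhi g φ P X)
    (x : ℝ) : (premiumSet g φ 0 P (fun ω => max (X ω - x) 0)).Nonempty := by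
  obtain ⟨a, ha, hi⟩ := hX.exists_integrable_max_sub hφ x
  have hy := (measurable_quantile_one_sub P X).ereal_toReal
  obtain ⟨a', h⟩ := hφ.exists_modular_le_one ha (fun u => le_max_right _ _)
    ((hy.sub_const x).max measurable_const) hi
  exact ⟨a', (hX.mem_premiumSet_max_sub_iff hφ x).2 h⟩

theorem MemLgPhi.distortionRisk_le_shiftedPremium (hφ : IsYoungFunction φ) (hφ1 : φ 1 = 1)
    (hX : MemLgPhi g φ P X) (x : ℝ) : distortionRisk g P X ≤ shiftedPremium g φ 0 P X x := by
  have hy := hX.integrable hφ hφ1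
  have hyx : Integrable (fun u => (quantile P X (1 - u)).toReal - x) g.measure :=
    hy.sub (integrable_const x)
  have hle : distortionRisk g P X - x ≤
      orliczLorentzPremium g φ 0 P (fun ω => max (X ω - x) 0) := by
    refine le_csInf (hX.premiumSet_max_sub_nonempty hφ x) fun a ha => ?_
    obtain ⟨ha0, hi, h1⟩ := (hX.mem_premiumSet_max_sub_iff hφ x).1 ha
    have h2 := hφ.integral_le_of_modular_le_one hφ1 ha0 (fun u => le_max_right _ _) hyx.pos_part
      hi h1
    refine le_trans ?_ h2
    -- E y - x ≤ E (y - x)⁺.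
    have h3 := integral_mono hyx hyx.pos_part fun u => le_max_left _ _
    rw [integral_sub hy (integrable_const x)] at h3
    simp only [integral_const, probReal_univ, one_smul] at h3
    exact h3
  rw [shiftedPremium]
  linarith

theorem MemLgPhi.bddBelow_range_shiftedPremium (hφ : IsYoungFunction φ) (hφ1 : φ 1 = 1)
    (hX : MemLgPhi g φ P X) : BddBelow (range (shiftedPremium g φ 0 P X)) :=
  ⟨distortionRisk g P X, by
    rintro _ ⟨x, rfl⟩
    exact hX.distortionRisk_le_shiftedPremium hφ hφ1 x⟩

theorem MemLgPhi.distortionRisk_le_distortionHG (hφ : IsYoungFunction φ) (hφ1 : φ 1 = 1)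
    (hX : MemLgPhi g φ P X) : distortionRisk g P X ≤ distortionHG g φ 0 P X :=
  le_ciInf fun x => hX.distortionRisk_le_shiftedPremium hφ hφ1 x

theorem MemLgPhi.distortionHG_le (hφ : IsYoungFunction φ) (hφ1 : φ 1 = 1) {cm cp : ℝ}
    (hm : HasDerivWithinAt φ cm (Iio 1) 1) (hp : HasDerivWithinAt φ cp (Ioi 1) 1)
    (hX : MemLgPhi g φ P X) :
    distortionHG g φ 0 P X ≤ cp / cm * distortionRisk g P (fun ω => max (X ω) 0) +
      cm / cp * distortionRisk g P (fun ω => -max (-X ω) 0) := by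
  have h := hX.ae_quantile_eq hφ
  have hy := (measurable_quantile_one_sub P X).ereal_toReal
  refine le_of_forall_gt_imp_ge_of_dense fun b hb => ?_
  rw [distortionRisk_eq_integral (ae_quantile_max h),
    distortionRisk_eq_integral (ae_quantile_neg_max_neg h)] at hb
  have hneg := expectile_integral_neg (hX.integrable hφ hφ1)
    (one_pos.trans_le (hφ.one_le_leftDeriv hφ1 hm)) (hφ.leftDeriv_le_rightDeriv hm hp) hb
  obtain ⟨a, ha, hlt⟩ := id hX
  obtain ⟨m, hmem⟩ := hφ.exists_shift_modular_le_one hφ1 hm hp ha hy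
    ((distortedModular_lt_top_iff hφ hy h ha).1 hlt) b hneg
  -- At the shift x = b - m the premium is at most m, so the sum is at most b.
  refine (ciInf_le (hX.bddBelow_range_shiftedPremium hφ hφ1) (b - m)).trans ?_
  have h1 : orliczLorentzPremium g φ 0 P (fun ω => max (X ω - (b - m)) 0) ≤ m :=
    csInf_le (bddBelow_premiumSet _ _ _ _ _) ((hX.mem_premiumSet_max_sub_iff hφ _).2 hmem)
  rw [shiftedPremium]
  linarith

end Representation

theorem theorem5 {Ω : Type*} [MeasurableSpace Ω] (P : Measure Ω) [IsProbabilityMeasure P]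
    (g : DistortionFunction) (φ : ℝ → ℝ) (hφ : IsYoungFunction φ) (hφ1 : φ 1 = 1) :
    -- every bounded risk lies in `L_g^φ`
    (∀ X : Ω → ℝ, Measurable X → MemLp X ⊤ P → MemLgPhi g φ P X) ∧
    -- all quantities below are well defined for risks in `L_g^φ`
    (∀ X : Ω → ℝ, Measurable X → MemLgPhi g φ P X →
      MemLg g P X ∧
      MemLg g P (fun ω => max (X ω) 0) ∧
      MemLg g P (fun ω => - max (- X ω) 0) ∧
      (∀ x : ℝ, MemLgPhi g φ P (fun ω => max (X ω - x) 0) ∧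
        (premiumSet g φ 0 P (fun ω => max (X ω - x) 0)).Nonempty) ∧
      BddBelow (Set.range (shiftedPremium g φ 0 P X))) ∧
    -- the one-sided derivatives of `φ` at `1` exist, are positive, and give the bounds
    ∃ cm cp : ℝ, HasDerivWithinAt φ cm (Set.Iio 1) 1 ∧ HasDerivWithinAt φ cp (Set.Ioi 1) 1 ∧
      0 < cm ∧ 0 < cp ∧
      (∀ X : Ω → ℝ, Measurable X → MemLp X ⊤ P →
        distortionRisk g P X ≤ distortionHG g φ 0 P X ∧
        distortionHG g φ 0 P X ≤
          cp / cm * distortionRisk g P (fun ω => max (X ω) 0) +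
          cm / cp * distortionRisk g P (fun ω => - max (- X ω) 0)) ∧
      (DeltaTwo φ → ∀ X : Ω → ℝ, Measurable X → MemLgPhi g φ P X →
        distortionRisk g P X ≤ distortionHG g φ 0 P X ∧
        distortionHG g φ 0 P X ≤
          cp / cm * distortionRisk g P (fun ω => max (X ω) 0) +
          cm / cp * distortionRisk g P (fun ω => - max (- X ω) 0)) := by
  obtain ⟨cm, hm⟩ := hφ.exists_leftDeriv
  obtain ⟨cp, hp⟩ := hφ.exists_rightDeriv
  have hcm : 0 < cm := one_pos.trans_le (hφ.one_le_leftDeriv hφ1 hm)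
  have hbdd : ∀ X : Ω → ℝ, MemLp X ⊤ P → MemLgPhi g φ P X := fun X hX => by
    -- The essential supremum of |X| serves as the almost sure bound.
    refine memLgPhi_of_ae_abs_le hφ (C := (eLpNorm X ⊤ P).toReal) ?_
    rw [eLpNorm_exponent_top]
    filter_upwards [ae_le_eLpNormEssSup (f := X) (μ := P)] with ω hω
    rw [Real.enorm_eq_ofReal_abs] at hω
    exact (ENNReal.ofReal_le_iff_le_toReal
      (eLpNorm_exponent_top (f := X) (μ := P) ▸ hX.2.ne)).1 hω
  have hmain : ∀ X : Ω → ℝ, MemLgPhi g φ P X →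
      distortionRisk g P X ≤ distortionHG g φ 0 P X ∧
      distortionHG g φ 0 P X ≤ cp / cm * distortionRisk g P (fun ω => max (X ω) 0) +
        cm / cp * distortionRisk g P (fun ω => - max (- X ω) 0) := fun X hX =>
    ⟨hX.distortionRisk_le_distortionHG hφ hφ1, hX.distortionHG_le hφ hφ1 hm hp⟩
  refine ⟨fun X _ => hbdd X, fun X _ hX => ?_, cm, cp, hm, hp, hcm,
    hcm.trans_le (hφ.leftDeriv_le_rightDeriv hm hp), fun X _ hX => hmain X (hbdd X hX),
    fun _ X _ hX => hmain X hX⟩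
  have h := hX.ae_quantile_eq hφ
  have hy := hX.integrable hφ hφ1
  exact ⟨memLg_of_integrable h hy, memLg_of_integrable (ae_quantile_max h) hy.pos_part,
    memLg_of_integrable (ae_quantile_neg_max_neg h) hy.neg_part.neg,
    fun x => ⟨hX.max_sub hφ x, hX.premiumSet_max_sub_nonempty hφ x⟩,
    hX.bddBelow_range_shiftedPremium hφ hφ1⟩
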